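/- Let $p$ be a prime, let $K$ be a finite extension of $\mathbb{Q}_p$ and let $E/K$ be a ramified quadratic field extension with non-trivial automorphism $\bar{\phantom{x}}$. Let $\mathfrak{o}$ and $\mathcal{O}$ be the rings of integers of $K$ and $E$. Let $V$ be a finite-dimensional vector space over $E$ with a non-degenerate hermitian form $h$, linear in the first variable, and let $L \subseteq V$ be a finitely generated $\mathcal{O}$-submodule spanning $V$ over $E$, whose trace form is even, that is, $\operatorname{Tr}_{E/\mathbb{Q}_p}(h(x,x)) \in 2\mathbb{Z}_p$ for all $x \in L$. Let $L^\vee = \{x \in V \mid \operatorname{Tr}_{E/\mathbb{Q}_p}(h(x,y)) \in \mathbb{Z}_p \text{ for all } y \in L\}$ be the dual lattice for the trace form, $D_L = L^\vee/L$ the discriminant group, and $U(D_L)$ the group of $\mathcal{O}$-linear automorphisms of $D_L$ that preserve the torsion quadratic form $D_L \to K/\mathfrak{D}_{K/\mathbb{Q}_p}^{-1}$, $[x] \mapsto [h(x,x)]$, where $\mathfrak{D}_{K/\mathbb{Q}_p}^{-1} = \{c \in K \mid \operatorname{Tr}_{K/\mathbb{Q}_p}(c\,\mathfrak{o}) \subseteq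 \mathbb{Z}_p\}$. Let $U(L)$ be the group of $E$-linear isometries $\varphi$ of $(V,h)$ with $\varphi(L) = L$, and let $U^\sharp(L)$ be the kernel of the natural homomorphism $U(L) \to U(D_L)$. A symmetry of $V$ is a linear map $S_{s,\sigma}\colon V \to V$, $x \mapsto x - h(x,s)\sigma^{-1}s$, where $s \in V$ and $\sigma \in E^\times$ satisfy $h(s,s) = \operatorname{Tr}_{E/K}(\sigma)$. Let $S(L)$ be the subgroup of $U(L)$ generated by the symmetries that preserve $L$, and let $S^\sharp(L) = U^\sharp(L) \cap S(L)$. Then $U^\sharp(L) = S^\sharp(L)$. Moreover, $U^\sharp(L)$ is generated by the symmetries it contains. -/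

import Mathlib

noncomputable section

namespace HermLattice

section

variable (p : ℕ) [Fact p.Prime]

/-- The maximal order (ring of integers) of a finite extension `A` of `ℚ_[p]`. -/
abbrev MaxOrder (A : Type*) [Field A] [Algebra ℤ_[p] A] : Subalgebra ℤ_[p] A :=
  integralClosure ℤ_[p] A

variable (K : Type*) [Field K] [Algebra ℤ_[p] K] [Algebra ℚ_[p] K] [IsScalarTower ℤ_[p] ℚ_[p] K]
variable (E : Type*) [Field E] [Algebra ℤ_[p] E] [Algebra ℚ_[p] E] [IsScalarTower ℤ_[p] ℚ_[p] E]
variable [Algebra K E] [IsScalarTower ℚ_[p] K E]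

/-- `E/K` is ramified: the maximal ideal of the ring of integers of `K` generates an ideal
contained in the square of the maximal ideal of the ring of integers of `E`
(ramification index at least two). -/
def IsRamified [IsScalarTower ℤ_[p] K E] : Prop :=
  ∃ (𝔭 : Ideal (MaxOrder p K)) (𝔓 : Ideal (MaxOrder p E)), 𝔭.IsMaximal ∧ 𝔓.IsMaximal ∧
    𝔭.map (IsScalarTower.toAlgHom ℤ_[p] K E).mapIntegralClosure ≤ 𝔓 ^ 2

/-- The inverse different `{c ∈ K | Tr_{K/ℚ_p}(c 𝔬) ⊆ ℤ_p}` of `K` over `ℚ_p`. -/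
def invDifferent : Set K :=
  {c | ∀ a : MaxOrder p K, Algebra.trace ℚ_[p] K (c * (a : K)) ∈ PadicInt.subring p}

variable {K E} {conj : E ≃ₐ[K] E}
variable {V : Type*} [AddCommGroup V] [Module E V]

/-- `h` is a hermitian form, linear in the first variable and semilinear in the second, with
respect to the involution `conj`. -/
def IsHermitian (h : V →ₗ[E] V →ₛₗ[(conj : E →+* E)] E) : Prop :=
  ∀ x y, conj (h x y) = h y x

/-- The trace form `b = Tr_{E/ℚ_p} ∘ h`. -/
def traceForm (h : V →ₗ[E] V →ₛₗ[(conj : E →+* E)] E) (x y : V) : ℚ_[p] :=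
  Algebra.trace ℚ_[p] E (h x y)

/-- The trace form on the lattice `L` is even: `Tr_{E/ℚ_p}(h(x,x)) ∈ 2 ℤ_p` for all `x ∈ L`. -/
def HasEvenTraceForm (h : V →ₗ[E] V →ₛₗ[(conj : E →+* E)] E)
    (L : Submodule (MaxOrder p E) V) : Prop :=
  ∀ x ∈ L, ∃ z : ℤ_[p], traceForm p h x x = 2 * (z : ℚ_[p])

theorem isIntegral_conj (τ : E ≃ₐ[K] E) (α : MaxOrder p E) : IsIntegral ℤ_[p] (τ (α : E)) := by
  have hc : ∀ c : ℤ_[p], algebraMap ℤ_[p] E c = algebraMap K E (algebraMap ℚ_[p] K (c : ℚ_[p])) := by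
    intro c
    rw [← IsScalarTower.algebraMap_apply ℚ_[p] K E, IsScalarTower.algebraMap_apply ℤ_[p] ℚ_[p] E]
    rfl
  let f : E →ₐ[ℤ_[p]] E :=
    { (τ : E →+* E) with
      commutes' := fun c => by
        rw [hc]
        exact τ.commutes _ }
  exact IsIntegral.map f (show IsIntegral ℤ_[p] (α : E) from α.2)

/-- The dual lattice `L^∨` of `L` with respect to the trace form. -/
def dualLattice (h : V →ₗ[E] V →ₛₗ[(conj : E →+* E)] E)
    (L : Submodule (MaxOrder p E) V) : Submodule (MaxOrder p E) V where
  carrier := {x | ∀ y ∈ L, traceForm p h x y ∈ PadicInt.subring p}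
  zero_mem' := by
    intro y _
    simp [traceForm]
  add_mem' := by
    intro a b ha hb y hy
    have := (PadicInt.subring p).add_mem (ha y hy) (hb y hy)
    simpa [traceForm] using this
  smul_mem' := by
    intro α x hx y hy
    have e1 : h (α • x) y = (α : E) * h x y := by
      rw [show α • x = (α : E) • x from rfl]
      simp
    have e2 : h x ((⟨conj.symm (α : E), isIntegral_conj p conj.symm α⟩ : MaxOrder p E) • y)
        = (α : E) * h x y := by
      rw [show ((⟨conj.symm (α : E), isIntegral_conj p conj.symm α⟩ : MaxOrder p E) • y)
        = conj.symm (α : E) • y from rfl, map_smulₛₗ]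
      simp
    have h3 := hx _ (L.smul_mem ⟨conj.symm (α : E), isIntegral_conj p conj.symm α⟩ hy)
    rw [traceForm, e2] at h3
    rwa [traceForm, e1]

/-- The discriminant group `D_L = L^∨ / L`, an `𝒪`-module. -/
abbrev Disc (h : V →ₗ[E] V →ₛₗ[(conj : E →+* E)] E) (L : Submodule (MaxOrder p E) V) : Type _ :=
  dualLattice p h L ⧸ L.submoduleOf (dualLattice p h L)

/-- The torsion quadratic form `D_L → K / 𝔇⁻¹`, `[x] ↦ [h(x,x)]`, where `𝔇⁻¹` is the inverse
different of `K` over `ℚ_p`. An element of `K / 𝔇⁻¹` is given as a coset in `K`: the value at `ξ`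
is the set of all `h(x,x) + d` where `x` represents `ξ` and `d ∈ 𝔇⁻¹`. -/
def discForm (h : V →ₗ[E] V →ₛₗ[(conj : E →+* E)] E) (L : Submodule (MaxOrder p E) V)
    (ξ : Disc p h L) : Set K :=
  {c | ∃ x : dualLattice p h L, Submodule.Quotient.mk x = ξ ∧
    ∃ d ∈ invDifferent p K, algebraMap K E c = h (x : V) (x : V) + algebraMap K E d}

/-- `U(D_L)`: the `𝒪`-linear automorphisms of `D_L` preserving its torsion quadratic form. -/
def unitaryDisc (h : V →ₗ[E] V →ₛₗ[(conj : E →+* E)] E) (L : Submodule (MaxOrder p E) V) :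
    Subgroup (Disc p h L ≃ₗ[MaxOrder p E] Disc p h L) where
  carrier := {g | ∀ ξ, discForm p h L (g ξ) = discForm p h L ξ}
  one_mem' := fun _ => rfl
  mul_mem' := fun {a b} ha hb ξ => (ha (b ξ)).trans (hb ξ)
  inv_mem' := fun {a} ha ξ => by
    have := ha (a⁻¹ ξ)
    rw [show a (a⁻¹ ξ) = ξ from a.apply_symm_apply ξ] at this
    exact this.symm

/-- `U(L)`: the isometries of the hermitian space `(V, h)` that map the lattice `L` onto itself. -/
def unitaryGroup (h : V →ₗ[E] V →ₛₗ[(conj : E →+* E)] E) (L : Submodule (MaxOrder p E) V) :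
    Subgroup (V ≃ₗ[E] V) where
  carrier := {φ | (∀ x y, h (φ x) (φ y) = h x y) ∧ ∀ x, φ x ∈ L ↔ x ∈ L}
  one_mem' := ⟨fun _ _ => rfl, fun _ => Iff.rfl⟩
  mul_mem' := fun {a b} ha hb =>
    ⟨fun x y => (ha.1 (b x) (b y)).trans (hb.1 x y), fun x => (ha.2 (b x)).trans (hb.2 x)⟩
  inv_mem' := fun {a} ha => by
    have key : ∀ x, a (a⁻¹ x) = x := fun x => a.apply_symm_apply x
    refine ⟨fun x y => ?_, fun x => ?_⟩
    · rw [← ha.1 (a⁻¹ x) (a⁻¹ y), key, key]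
    · rw [← ha.2 (a⁻¹ x), key]

variable {p}
variable {h : V →ₗ[E] V →ₛₗ[(conj : E →+* E)] E} {L : Submodule (MaxOrder p E) V}

theorem unitary_mem_dual (φ : unitaryGroup p h L) {x : V} (hx : x ∈ dualLattice p h L) :
    (φ : V ≃ₗ[E] V) x ∈ dualLattice p h L := by
  intro y hy
  have key : (φ : V ≃ₗ[E] V) (((φ⁻¹ : unitaryGroup p h L) : V ≃ₗ[E] V) y) = y :=
    (φ : V ≃ₗ[E] V).apply_symm_apply y
  have h1 := hx _ (((φ⁻¹).2.2 y).2 hy)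
  rw [traceForm, ← φ.2.1, key] at h1
  exact h1

/-- The action of an element of `U(L)` on the dual lattice. -/
def dualMap (φ : unitaryGroup p h L) :
    dualLattice p h L →ₗ[MaxOrder p E] dualLattice p h L where
  toFun x := ⟨(φ : V ≃ₗ[E] V) x, unitary_mem_dual φ x.2⟩
  map_add' x y := Subtype.ext (map_add (φ : V ≃ₗ[E] V) (x : V) (y : V))
  map_smul' a x := Subtype.ext (map_smul (φ : V ≃ₗ[E] V) (a : E) (x : V))

/-- The map `D_φ : D_L → D_L`, `[x] ↦ [φ x]`, induced by `φ ∈ U(L)`. -/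
def discMap (φ : unitaryGroup p h L) : Disc p h L →ₗ[MaxOrder p E] Disc p h L :=
  Submodule.mapQ _ _ (dualMap φ) (fun x hx => (φ.2.2 (x : V)).2 hx)

theorem discMap_mul (φ ψ : unitaryGroup p h L) (ξ : Disc p h L) :
    discMap (φ * ψ) ξ = discMap φ (discMap ψ ξ) := by
  induction ξ using Submodule.Quotient.induction_on with
  | H x => rfl

theorem discMap_one (ξ : Disc p h L) : discMap (1 : unitaryGroup p h L) ξ = ξ := by
  induction ξ using Submodule.Quotient.induction_on with
  | H x => rfl

theorem discForm_discMap_subset (φ : unitaryGroup p h L) (ξ : Disc p h L) :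
    discForm p h L ξ ⊆ discForm p h L (discMap φ ξ) := by
  rintro c ⟨x, rfl, d, hd, hc⟩
  refine ⟨dualMap φ x, rfl, d, hd, ?_⟩
  rw [hc]
  congr 1
  exact (φ.2.1 (x : V) (x : V)).symm

theorem discForm_discMap (φ : unitaryGroup p h L) (ξ : Disc p h L) :
    discForm p h L (discMap φ ξ) = discForm p h L ξ := by
  refine Set.Subset.antisymm ?_ (discForm_discMap_subset φ ξ)
  have h1 := discForm_discMap_subset φ⁻¹ (discMap φ ξ)
  rwa [← discMap_mul, inv_mul_cancel, discMap_one] at h1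

/-- `D_φ` as a linear automorphism of `D_L`. -/
def discEquiv (φ : unitaryGroup p h L) : Disc p h L ≃ₗ[MaxOrder p E] Disc p h L where
  __ := discMap φ
  invFun := discMap φ⁻¹
  left_inv ξ := by
    change discMap φ⁻¹ (discMap φ ξ) = ξ
    rw [← discMap_mul, inv_mul_cancel, discMap_one]
  right_inv ξ := by
    change discMap φ (discMap φ⁻¹ ξ) = ξ
    rw [← discMap_mul, mul_inv_cancel, discMap_one]

variable (p h L)

/-- The natural homomorphism `U(L) → U(D_L)`. -/
def toUnitaryDisc : unitaryGroup p h L →* unitaryDisc p h L where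
  toFun φ := ⟨discEquiv φ, fun ξ => discForm_discMap φ ξ⟩
  map_one' := Subtype.ext (LinearEquiv.ext discMap_one)
  map_mul' φ ψ := Subtype.ext (LinearEquiv.ext (discMap_mul φ ψ))

/-- `U^♯(L)`: the kernel of `U(L) → U(D_L)`. -/
def unitarySharp : Subgroup (unitaryGroup p h L) := (toUnitaryDisc p h L).ker

variable {p L} in
/-- A symmetry of `(V, h)`: a map `x ↦ x - h(x,s) σ⁻¹ s` where `s ∈ V`, `σ ∈ E^×` and
`h(s,s) = Tr_{E/K}(σ)`. -/
def IsSymmetry (φ : V ≃ₗ[E] V) : Prop :=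
  ∃ (s : V) (σ : E), σ ≠ 0 ∧ h s s = algebraMap K E (Algebra.trace K E σ) ∧
    ∀ x, φ x = x - (h x s * σ⁻¹) • s

/-- `S(L)`: the subgroup of `U(L)` generated by the symmetries preserving `L`. -/
def symmetryGroup : Subgroup (unitaryGroup p h L) :=
  Subgroup.closure {φ | IsSymmetry h (φ : V ≃ₗ[E] V)}

/-- `S^♯(L) = U^♯(L) ∩ S(L)`. -/
def symmetrySharp : Subgroup (unitaryGroup p h L) :=
  unitarySharp p h L ⊓ symmetryGroup p h L

end

end HermLattice

end

set_option linter.unusedSectionVars false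

noncomputable section

namespace HermLattice

/-! ### Integers, uniformizers and the inverse different of a finite extension of ℚ_p. -/

section Arithmetic

variable {p : ℕ} [Fact p.Prime]
variable {A : Type*} [Field A] [Algebra ℤ_[p] A] [Algebra ℚ_[p] A] [IsScalarTower ℤ_[p] ℚ_[p] A]

/-! The inverse different of E is ω𝒪 for some ω. If s ∈ L and σ generates ω𝒪, then S_{s,σ} lies in
U^♯(L), because h(x,s)σ⁻¹ is integral for every x ∈ L^∨ (`exists_symmetry_mem_unitarySharp`).

Let φ ∈ U^♯(L) and f ∈ L^∨, and put s = f - φf, an element of L. If h(f,s) generates ω𝒪, the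
symmetry with σ = h(f,s) carries f to φf (`exists_symmetry_apply_eq`). Otherwise choose e ∈ L with
h(f,e) = ω. One of e, φe, e + φe is a vector t ∈ L for which h(f,t) and h(φf,t) both generate ω𝒪.
Replacing φ by S_{t,τ}φ, with τ a generator, changes h(f, f - φf) by a generator, so the first case
applies (`exists_closure_mul_apply_eq`). The symmetries used fix every x with φx = x and h(x,e) = 0.
Hence a system f_i dual to a basis e_i of L can be brought back one vector at a time, until φ has
become the identity.

Ramification supplies τ: every element of the inverse different of K is the trace of a generator of
ω𝒪 (`exists_generator_trace_eq`), and evenness puts h(t,t) in that inverse different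
(`exists_self_eq_of_mem`). -/

theorem mem_padicInt_subring_of_isIntegral {x : ℚ_[p]} (hx : IsIntegral ℤ_[p] x) :
    x ∈ PadicInt.subring p := by
  obtain ⟨y, rfl⟩ := IsIntegrallyClosed.isIntegral_iff.1 hx
  exact y.2

theorem trace_mem_of_isIntegral [FiniteDimensional ℚ_[p] A] {x : A} (hx : IsIntegral ℤ_[p] x) :
    Algebra.trace ℚ_[p] A x ∈ PadicInt.subring p :=
  mem_padicInt_subring_of_isIntegral (Algebra.isIntegral_trace hx)

/-- If the spectral norm of `x` is at most one, then `x` is integral over `ℤ_p`. -/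
theorem isIntegral_of_spectralNorm_le_one [FiniteDimensional ℚ_[p] A] {x : A}
    (hx : spectralNorm ℚ_[p] A x ≤ 1) : IsIntegral ℤ_[p] x := by
  have hi : IsIntegral ℚ_[p] x := Algebra.IsIntegral.isIntegral x
  have hc := (spectralValue_le_one_iff (minpoly.monic hi)).1 hx
  have hl : minpoly ℚ_[p] x ∈ Polynomial.lifts (algebraMap ℤ_[p] ℚ_[p]) := by
    rw [Polynomial.lifts_iff_coeff_lifts]
    intro n
    exact ⟨⟨_, hc n⟩, rfl⟩
  obtain ⟨q, hq, -, hm⟩ := Polynomial.lifts_and_natDegree_eq_and_monic hl (minpoly.monic hi)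
  refine ⟨q, hm, ?_⟩
  rw [IsScalarTower.algebraMap_eq ℤ_[p] ℚ_[p] A, ← Polynomial.eval₂_map, hq]
  exact minpoly.aeval _ _

/-- The spectral norm is multiplicative, so x and x⁻¹ cannot both have norm above one. -/
theorem mem_maxOrder_or_inv_mem [FiniteDimensional ℚ_[p] A] (x : A) :
    x ∈ MaxOrder p A ∨ x⁻¹ ∈ MaxOrder p A := by
  rcases eq_or_ne x 0 with rfl | h0
  · exact Or.inl (zero_mem _)
  have hmul : spectralNorm ℚ_[p] A x * spectralNorm ℚ_[p] A x⁻¹ = 1 := by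
    have h1 := spectralAlgNorm_mul (K := ℚ_[p]) x x⁻¹
    rw [mul_inv_cancel₀ h0, spectralAlgNorm_one] at h1
    exact h1.symm
  by_contra! hcon
  have h1 : 1 < spectralNorm ℚ_[p] A x :=
    lt_of_not_ge fun hle => hcon.1 (isIntegral_of_spectralNorm_le_one hle)
  have h2 : 1 < spectralNorm ℚ_[p] A x⁻¹ :=
    lt_of_not_ge fun hle => hcon.2 (isIntegral_of_spectralNorm_le_one hle)
  nlinarith

variable (p A) in
theorem isFractionRing_maxOrder [FiniteDimensional ℚ_[p] A] : IsFractionRing (MaxOrder p A) A :=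
  integralClosure.isFractionRing_of_finite_extension ℚ_[p] A

theorem inv_natCast_prime_notMem [FiniteDimensional ℚ_[p] A] : (p : A)⁻¹ ∉ MaxOrder p A := by
  intro hmem
  have h1 : IsIntegral ℤ_[p] (algebraMap ℚ_[p] A (p : ℚ_[p])⁻¹) := by
    rw [map_inv₀, map_natCast]
    exact hmem
  have h2 := mem_padicInt_subring_of_isIntegral
    ((isIntegral_algebraMap_iff (algebraMap ℚ_[p] A).injective).1 h1)
  have h3 : ‖(p : ℚ_[p])⁻¹‖ ≤ 1 := h2
  rw [norm_inv, Padic.norm_p, inv_inv] at h3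
  have := (Fact.out : p.Prime).one_lt
  have h4 : (1 : ℝ) < p := by exact_mod_cast this
  linarith

-- A Noetherian valuation ring is a discrete valuation ring unless it is a field; it is not one
-- because p is not invertible in it.
variable (p A) in
theorem isDiscreteValuationRing_maxOrder [FiniteDimensional ℚ_[p] A] :
    IsDiscreteValuationRing (MaxOrder p A) := by
  have hfr := isFractionRing_maxOrder p A
  have hnoeth : IsNoetherianRing (MaxOrder p A) := integralClosure.isNoetherianRing (A := ℤ_[p]) (K := ℚ_[p]) (L := A)
  have hval : ValuationRing (MaxOrder p A) := by
    rw [ValuationRing.iff_isInteger_or_isInteger (MaxOrder p A) A]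
    intro x
    exact (mem_maxOrder_or_inv_mem (p := p) x).imp (fun h => ⟨⟨x, h⟩, rfl⟩)
      (fun h => ⟨⟨_, h⟩, rfl⟩)
  refine ((IsDiscreteValuationRing.TFAE (MaxOrder p A) ?_).out 0 1).2 hval
  intro hF
  have hp0 : (p : MaxOrder p A) ≠ 0 := by
    intro h0
    apply inv_natCast_prime_notMem (p := p) (A := A)
    have : (p : A) = 0 := by
      simpa using congrArg (Subtype.val : MaxOrder p A → A) h0
    rw [this, inv_zero]
    exact zero_mem _
  obtain ⟨b, hb⟩ := hF.mul_inv_cancel hp0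
  apply inv_natCast_prime_notMem (p := p) (A := A)
  have hb' : (p : A) * b = 1 := by simpa using congrArg (Subtype.val : MaxOrder p A → A) hb
  rw [← eq_inv_of_mul_eq_one_right hb']
  exact b.2

variable (p) in
/-- `ϖ` is a uniformizer of the maximal order of `A`. -/
structure IsUniformizer (ϖ : A) : Prop where
  ne_zero : ϖ ≠ 0
  mem : ϖ ∈ MaxOrder p A
  inv_notMem : ϖ⁻¹ ∉ MaxOrder p A
  div_mem : ∀ x : A, x⁻¹ ∉ MaxOrder p A → x / ϖ ∈ MaxOrder p A

theorem isUnit_of_inv_mem {x : MaxOrder p A} (h0 : (x : A) ≠ 0) (h : (x : A)⁻¹ ∈ MaxOrder p A) :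
    IsUnit x :=
  IsUnit.of_mul_eq_one ⟨_, h⟩ (Subtype.ext (mul_inv_cancel₀ h0))

theorem inv_mem_of_isUnit {x : MaxOrder p A} (h : IsUnit x) : (x : A)⁻¹ ∈ MaxOrder p A := by
  obtain ⟨u, rfl⟩ := h
  have h1 : ((u : MaxOrder p A) : A) * ((u⁻¹ : (MaxOrder p A)ˣ) : MaxOrder p A) = 1 :=
    congrArg Subtype.val u.mul_inv
  rw [← eq_inv_of_mul_eq_one_right h1]
  exact Subtype.prop _

theorem isUniformizer_of_irreducible [FiniteDimensional ℚ_[p] A] {ϖ : MaxOrder p A}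
    (h : Irreducible ϖ) : IsUniformizer p (ϖ : A) := by
  have := isDiscreteValuationRing_maxOrder p A
  have h0 : (ϖ : A) ≠ 0 := fun h0 => h.ne_zero (Subtype.ext h0)
  refine ⟨h0, ϖ.2, fun hi => h.not_isUnit (isUnit_of_inv_mem h0 hi), fun x hx => ?_⟩
  have hx' : x ∈ MaxOrder p A := (mem_maxOrder_or_inv_mem x).resolve_right hx
  have hnu : ¬ IsUnit (⟨x, hx'⟩ : MaxOrder p A) := fun hu => hx (inv_mem_of_isUnit hu)
  have hm : (⟨x, hx'⟩ : MaxOrder p A) ∈ IsLocalRing.maximalIdeal (MaxOrder p A) := hnu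
  rw [h.maximalIdeal_eq, Ideal.mem_span_singleton] at hm
  obtain ⟨c, hc⟩ := hm
  have hc' : x = ϖ * c := congrArg Subtype.val hc
  rw [hc', mul_div_cancel_left₀ _ h0]
  exact c.2

theorem IsUniformizer.irreducible [FiniteDimensional ℚ_[p] A] {ϖ : A}
    (h : IsUniformizer p ϖ) : Irreducible (⟨ϖ, h.mem⟩ : MaxOrder p A) := by
  have := isDiscreteValuationRing_maxOrder p A
  rw [IsDiscreteValuationRing.irreducible_iff_uniformizer]
  ext y
  rw [Ideal.mem_span_singleton, IsLocalRing.mem_maximalIdeal, mem_nonunits_iff]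
  constructor
  · intro hy
    rcases eq_or_ne (y : A) 0 with h0 | h0
    · rw [show y = 0 from Subtype.ext h0]
      exact dvd_zero _
    · exact ⟨⟨_, h.div_mem y fun hi => hy (isUnit_of_inv_mem h0 hi)⟩,
        Subtype.ext (mul_div_cancel₀ _ h.ne_zero).symm⟩
  · rintro hd hu
    exact h.inv_notMem (inv_mem_of_isUnit (isUnit_of_dvd_unit hd hu))

theorem IsUniformizer.exists_pow_mul_mem [FiniteDimensional ℚ_[p] A] {ϖ : A}
    (h : IsUniformizer p ϖ) (x : A) : ∃ m : ℕ, ϖ ^ m * x ∈ MaxOrder p A := by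
  have := isDiscreteValuationRing_maxOrder p A
  have := isFractionRing_maxOrder p A
  obtain ⟨a, b, hb, rfl⟩ := IsFractionRing.div_surjective (A := MaxOrder p A) x
  obtain ⟨n, u, hn⟩ := IsDiscreteValuationRing.eq_unit_mul_pow_irreducible
    (nonZeroDivisors.ne_zero hb) h.irreducible
  refine ⟨n, ?_⟩
  have hb' : (b : A) = ((u : MaxOrder p A) : A) * ϖ ^ n := by
    simpa using congrArg Subtype.val hn
  have hu0 : ((u : MaxOrder p A) : A) ≠ 0 := fun h0 => u.ne_zero (Subtype.ext h0)
  have : ϖ ^ n * (algebraMap (MaxOrder p A) A a / algebraMap (MaxOrder p A) A b)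
      = (a : A) * ((u : MaxOrder p A) : A)⁻¹ := by
    change ϖ ^ n * ((a : A) / (b : A)) = _
    rw [hb']
    have := pow_ne_zero n h.ne_zero
    field_simp
  rw [this]
  exact mul_mem a.2 (inv_mem_of_isUnit u.isUnit)

/-! ### The inverse different as a principal fractional ideal. -/

theorem mul_mem_invDifferent {c a : A} (hc : c ∈ invDifferent p A) (ha : a ∈ MaxOrder p A) :
    c * a ∈ invDifferent p A := by
  intro b
  rw [mul_assoc]
  exact hc ⟨a * b, mul_mem ha b.2⟩

theorem sub_mem_invDifferent {c d : A} (hc : c ∈ invDifferent p A) (hd : d ∈ invDifferent p A) :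
    c - d ∈ invDifferent p A := by
  intro a
  rw [sub_mul, map_sub]
  exact sub_mem (hc a) (hd a)

theorem mem_invDifferent_of_mem_maxOrder [FiniteDimensional ℚ_[p] A] {c : A}
    (hc : c ∈ MaxOrder p A) : c ∈ invDifferent p A :=
  fun a => trace_mem_of_isIntegral (mul_mem hc a.2)

variable (p A) in
theorem exists_notMem_invDifferent [FiniteDimensional ℚ_[p] A] :
    ∃ x : A, x ∉ invDifferent p A := by
  by_contra! hall
  obtain ⟨y, hy⟩ := Algebra.trace_surjective ℚ_[p] A (p : ℚ_[p])⁻¹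
  have h1 := hall y 1
  rw [OneMemClass.coe_one, mul_one, hy] at h1
  have h3 : ‖(p : ℚ_[p])⁻¹‖ ≤ 1 := h1
  rw [norm_inv, Padic.norm_p, inv_inv] at h3
  have h4 : (1 : ℝ) < p := by exact_mod_cast (Fact.out : p.Prime).one_lt
  linarith

/-- The inverse different is principal. -/
theorem exists_generator_invDifferent [FiniteDimensional ℚ_[p] A] {ϖ : A}
    (h : IsUniformizer p ϖ) :
    ∃ ω : A, ω ≠ 0 ∧ ω ∈ invDifferent p A ∧ ∀ x ∈ invDifferent p A, x / ω ∈ MaxOrder p A := by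
  -- The generator is ϖ⁻ᵐ, where m + 1 is the least exponent that leaves the inverse different;
  -- exponent 0 never leaves it, since integers have integral trace.
  have hex : ∃ m : ℕ, ϖ⁻¹ ^ m ∉ invDifferent p A := by
    obtain ⟨x, hx⟩ := exists_notMem_invDifferent p A
    obtain ⟨m, hm⟩ := h.exists_pow_mul_mem x
    refine ⟨m, fun hmem => hx ?_⟩
    have := mul_mem_invDifferent hmem hm
    rwa [← mul_assoc, ← mul_pow, inv_mul_cancel₀ h.ne_zero, one_pow, one_mul] at this
  classical
  obtain ⟨m, hm⟩ : ∃ m, Nat.find hex = m + 1 := by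
    refine Nat.exists_eq_succ_of_ne_zero fun h0 => ?_
    have := Nat.find_spec hex
    rw [h0, pow_zero] at this
    exact this (mem_invDifferent_of_mem_maxOrder (one_mem _))
  have hmem : ϖ⁻¹ ^ m ∈ invDifferent p A := by
    by_contra hcon
    have := Nat.find_min' hex hcon
    omega
  have hnot : ϖ⁻¹ ^ (m + 1) ∉ invDifferent p A := hm ▸ Nat.find_spec hex
  have hω : ϖ⁻¹ ^ m ≠ 0 := pow_ne_zero _ (inv_ne_zero h.ne_zero)
  refine ⟨ϖ⁻¹ ^ m, hω, hmem, fun x hx => ?_⟩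
  by_contra hcon
  have hx0 : x ≠ 0 := by
    rintro rfl
    exact hcon (by simp)
  have h1 := h.div_mem (x / ϖ⁻¹ ^ m)⁻¹ (by rwa [inv_inv])
  apply hnot
  -- If x had larger denominator than ϖ⁻ᵐ, an integral multiple of x would equal ϖ⁻ᵐ⁻¹.
  have h2 := mul_mem_invDifferent hx h1
  have h3 : x * ((x / ϖ⁻¹ ^ m)⁻¹ / ϖ) = ϖ⁻¹ ^ (m + 1) := by
    rw [inv_div, pow_succ]
    have := h.ne_zero
    field_simp
  rwa [h3] at h2

/-- Modulo a uniformizer every element of the maximal order is a square if `p = 2`. -/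
theorem exists_sq_add_uniformizer_mul [FiniteDimensional ℚ_[p] A] (hp : p = 2) {ϖ : A}
    (h : IsUniformizer p ϖ) {a : A} (ha : a ∈ MaxOrder p A) :
    ∃ b ∈ MaxOrder p A, ∃ c ∈ MaxOrder p A, a = b * b + ϖ * c := by
  have := isDiscreteValuationRing_maxOrder p A
  have hfin : Module.Finite ℤ_[p] (MaxOrder p A) :=
    IsIntegralClosure.finite ℤ_[p] ℚ_[p] A (MaxOrder p A)
  have hfaith : FaithfulSMul ℤ_[p] A := by
    rw [faithfulSMul_iff_algebraMap_injective, IsScalarTower.algebraMap_eq ℤ_[p] ℚ_[p] A]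
    exact (algebraMap ℚ_[p] A).injective.comp (IsFractionRing.injective ℤ_[p] ℚ_[p])
  have hfaith' : FaithfulSMul ℤ_[p] (MaxOrder p A) := by
    rw [faithfulSMul_iff_algebraMap_injective]
    intro x y hxy
    exact FaithfulSMul.algebraMap_injective ℤ_[p] A (congrArg Subtype.val hxy)
  -- The residue field is finite of characteristic two, so each of its elements is a square.
  have hres : Finite (IsLocalRing.ResidueField ℤ_[p]) :=
    Finite.of_equiv (ZMod p) PadicInt.residueField.symm.toEquiv
  have hfink : Finite (IsLocalRing.ResidueField (MaxOrder p A)) :=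
    IsLocalRing.ResidueField.finite_of_finite (R := ℤ_[p]) hres
  have hchar : ringChar (IsLocalRing.ResidueField (MaxOrder p A)) = 2 := by
    have h2 : ((2 : ℕ) : IsLocalRing.ResidueField (MaxOrder p A)) = 0 := by
      have h3 : (2 : ZMod p) = 0 := by
        subst hp
        rfl
      have h4 := congrArg ((algebraMap (IsLocalRing.ResidueField ℤ_[p])
        (IsLocalRing.ResidueField (MaxOrder p A))).comp
          (PadicInt.residueField (p := p)).symm.toRingHom) h3
      rw [map_ofNat, map_zero] at h4
      exact_mod_cast h4
    exact CharP.ringChar_of_prime_eq_zero Nat.prime_two h2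
  obtain ⟨r, hr⟩ := FiniteField.isSquare_of_char_two hchar
    (IsLocalRing.residue (MaxOrder p A) ⟨a, ha⟩)
  obtain ⟨b, rfl⟩ := IsLocalRing.residue_surjective r
  have hm : (⟨a, ha⟩ : MaxOrder p A) - b * b ∈ IsLocalRing.maximalIdeal (MaxOrder p A) := by
    rw [← IsLocalRing.residue_eq_zero_iff, map_sub, map_mul, hr, sub_self]
  rw [h.irreducible.maximalIdeal_eq, Ideal.mem_span_singleton] at hm
  obtain ⟨c, hc⟩ := hm
  have hc' : a - (b : A) * b = ϖ * c := congrArg Subtype.val hc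
  exact ⟨b, b.2, c, c.2, by rw [← hc']; ring⟩

end Arithmetic

/-! ### Non-divisibility by a uniformizer. -/

section UniformizerDivisibility

variable {p : ℕ} [Fact p.Prime]
variable {A : Type*} [Field A] [Algebra ℤ_[p] A] [Algebra ℚ_[p] A] [IsScalarTower ℤ_[p] ℚ_[p] A]
variable {ϖ : A}

/-- Here and below, `x / ϖ ∉ MaxOrder p A` encodes that x has valuation at most zero; for integral x
it says that x is a unit. Applied to x / ω it detects generators of the inverse different. -/
theorem IsUniformizer.not_div_mem_of_inv_mem (h : IsUniformizer p ϖ) {x : A} (h0 : x ≠ 0)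
    (hx : x⁻¹ ∈ MaxOrder p A) : x / ϖ ∉ MaxOrder p A := by
  intro hd
  apply h.inv_notMem
  have := mul_mem hd hx
  rwa [div_mul_eq_mul_div, mul_inv_cancel₀ h0, one_div] at this

theorem IsUniformizer.inv_mem_of_not_div_mem (h : IsUniformizer p ϖ) {x : A}
    (hx : x / ϖ ∉ MaxOrder p A) : x⁻¹ ∈ MaxOrder p A :=
  not_not.1 fun hn => hx (h.div_mem x hn)

theorem ne_zero_of_not_div_mem {x : A} (hx : x / ϖ ∉ MaxOrder p A) : x ≠ 0 := by
  rintro rfl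
  exact hx (by simp)

theorem IsUniformizer.not_mul_div_mem (h : IsUniformizer p ϖ) {x y : A}
    (hx : x / ϖ ∉ MaxOrder p A) (hy : y / ϖ ∉ MaxOrder p A) : x * y / ϖ ∉ MaxOrder p A := by
  refine h.not_div_mem_of_inv_mem
    (mul_ne_zero (ne_zero_of_not_div_mem hx) (ne_zero_of_not_div_mem hy)) ?_
  rw [mul_inv]
  exact mul_mem (h.inv_mem_of_not_div_mem hx) (h.inv_mem_of_not_div_mem hy)

theorem not_add_div_mem {x y : A}
    (hx : x / ϖ ∈ MaxOrder p A) (hy : y / ϖ ∉ MaxOrder p A) : (x + y) / ϖ ∉ MaxOrder p A := by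
  intro hadd
  apply hy
  have := sub_mem hadd hx
  rwa [← sub_div, add_sub_cancel_left] at this

theorem IsUniformizer.not_one_div_mem (h : IsUniformizer p ϖ) : (1 : A) / ϖ ∉ MaxOrder p A := by
  rw [one_div]
  exact h.inv_notMem

end UniformizerDivisibility

/-! ### Traces and norms in a ramified quadratic extension. -/

section Quadratic

variable {p : ℕ} [Fact p.Prime]
variable {K : Type*} [Field K] [Algebra ℤ_[p] K] [Algebra ℚ_[p] K] [IsScalarTower ℤ_[p] ℚ_[p] K]
  [FiniteDimensional ℚ_[p] K]
variable {E : Type*} [Field E] [Algebra ℤ_[p] E] [Algebra ℚ_[p] E] [IsScalarTower ℤ_[p] ℚ_[p] E]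
  [FiniteDimensional ℚ_[p] E]
variable [Algebra K E] [IsScalarTower ℚ_[p] K E] [IsScalarTower ℤ_[p] K E]

theorem algebraMap_trace_quadratic {K E : Type*} [Field K] [Field E] [Algebra K E]
    (hquad : Module.finrank K E = 2) {conj : E ≃ₐ[K] E} (hconj : conj ≠ 1) (x : E) :
    algebraMap K E (Algebra.trace K E x) = x + conj x := by
  classical
  have hfd : FiniteDimensional K E := Module.finite_of_finrank_eq_succ hquad
  have hle : Nat.card (E ≃ₐ[K] E) ≤ 2 := by
    rw [← hquad, Nat.card_eq_fintype_card]
    exact AlgEquiv.card_le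
  have hpair : ({1, conj} : Finset (E ≃ₐ[K] E)).card = 2 := Finset.card_pair hconj.symm
  have huniv : ({1, conj} : Finset (E ≃ₐ[K] E)) = Finset.univ := by
    apply Finset.eq_univ_of_card
    refine le_antisymm (Finset.card_le_univ _) ?_
    rw [hpair, ← Nat.card_eq_fintype_card]
    exact hle
  have hgal : IsGalois K E := by
    apply IsGalois.of_card_aut_eq_finrank
    rw [hquad, Nat.card_eq_fintype_card, ← Finset.card_univ, ← huniv, hpair]
  rw [trace_eq_sum_automorphisms, ← huniv, Finset.sum_pair hconj.symm]
  rfl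

theorem conj_conj_quadratic {K E : Type*} [Field K] [Field E] [Algebra K E]
    (hquad : Module.finrank K E = 2) {conj : E ≃ₐ[K] E} (hconj : conj ≠ 1) (x : E) :
    conj (conj x) = x := by
  have h1 := algebraMap_trace_quadratic hquad hconj x
  have h2 := congrArg conj h1
  rw [AlgEquiv.commutes, h1, map_add, add_comm] at h2
  exact (add_left_cancel h2).symm

theorem exists_algebraMap_eq_of_conj_eq {K E : Type*} [Field K] [Field E] [Algebra K E]
    [CharZero E] (hquad : Module.finrank K E = 2) {conj : E ≃ₐ[K] E} (hconj : conj ≠ 1) {x : E}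
    (hx : conj x = x) : ∃ c : K, algebraMap K E c = x := by
  refine ⟨Algebra.trace K E (x / 2), ?_⟩
  rw [algebraMap_trace_quadratic hquad hconj, map_div₀, hx, map_ofNat, add_halves]

theorem mem_maxOrder_of_algebraMap_mem {x : K} (hx : algebraMap K E x ∈ MaxOrder p E) :
    x ∈ MaxOrder p K :=
  (isIntegral_algebraMap_iff (algebraMap K E).injective).1 hx

theorem algebraMap_mem_maxOrder {x : K} (hx : x ∈ MaxOrder p K) :
    algebraMap K E x ∈ MaxOrder p E :=
  IsIntegral.algebraMap (show IsIntegral ℤ_[p] x from hx)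

theorem conj_mem_maxOrder (conj : E ≃ₐ[K] E) {x : E} (hx : x ∈ MaxOrder p E) :
    conj x ∈ MaxOrder p E :=
  isIntegral_conj p conj ⟨x, hx⟩

theorem trace_trace_padic (x : E) :
    Algebra.trace ℚ_[p] K (Algebra.trace K E x) = Algebra.trace ℚ_[p] E x := by
  have : FiniteDimensional K E := FiniteDimensional.right ℚ_[p] K E
  exact Algebra.trace_trace x

theorem trace_mem_invDifferent {x : E} (hx : x ∈ invDifferent p E) :
    Algebra.trace K E x ∈ invDifferent p K := by
  intro a
  have h1 : Algebra.trace K E x * (a : K) = Algebra.trace K E (x * algebraMap K E a) := by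
    rw [mul_comm x, ← Algebra.smul_def, map_smul, smul_eq_mul, mul_comm]
  rw [h1, trace_trace_padic]
  exact hx ⟨_, algebraMap_mem_maxOrder a.2⟩

/-- Uniformizers of `K` and `E` in the ramified case. -/
theorem exists_uniformizers (hram : IsRamified p K E) :
    ∃ (π : K) (ϖ : E), IsUniformizer p π ∧ IsUniformizer p ϖ ∧
      algebraMap K E π / ϖ ^ 2 ∈ MaxOrder p E := by
  have hK := isDiscreteValuationRing_maxOrder p K
  have hE := isDiscreteValuationRing_maxOrder p E
  obtain ⟨𝔭, 𝔓, h𝔭, h𝔓, hle⟩ := hram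
  obtain ⟨π, hπ⟩ := IsDiscreteValuationRing.exists_irreducible (MaxOrder p K)
  obtain ⟨ϖ, hϖ⟩ := IsDiscreteValuationRing.exists_irreducible (MaxOrder p E)
  refine ⟨π, ϖ, isUniformizer_of_irreducible hπ, isUniformizer_of_irreducible hϖ, ?_⟩
  have hmem : π ∈ 𝔭 := by
    rw [IsLocalRing.eq_maximalIdeal h𝔭, hπ.maximalIdeal_eq]
    exact Ideal.mem_span_singleton_self _
  have h2 := hle (Ideal.mem_map_of_mem _ hmem)
  rw [IsLocalRing.eq_maximalIdeal h𝔓, hϖ.maximalIdeal_eq, Ideal.span_singleton_pow,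
    Ideal.mem_span_singleton] at h2
  obtain ⟨c, hc⟩ := h2
  have hc' : algebraMap K E π = (ϖ : E) ^ 2 * c := congrArg Subtype.val hc
  rw [hc', mul_div_cancel_left₀ _ (pow_ne_zero 2 (isUniformizer_of_irreducible hϖ).ne_zero)]
  exact c.2

variable {π : K} {ϖ ω : E}

/-- In the ramified case, every element of the inverse different of `K` is the trace of an
element of `ϖ 𝔇_E⁻¹`. -/
theorem exists_trace_eq_of_mem_invDifferent (hπ : IsUniformizer p π) (hϖ : IsUniformizer p ϖ)
    (hπϖ : algebraMap K E π / ϖ ^ 2 ∈ MaxOrder p E) (hω : ω ≠ 0)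
    (hgen : ∀ x ∈ invDifferent p E, x / ω ∈ MaxOrder p E) {c : K} (hc : c ∈ invDifferent p K) :
    ∃ τ : E, Algebra.trace K E τ = c ∧ τ / ω / ϖ ∈ MaxOrder p E := by
  by_contra! hcon
  have hϖ0 := hϖ.ne_zero
  have hπ0 := hπ.ne_zero
  have hπE : algebraMap K E π ≠ 0 := (map_ne_zero _).2 hπ0
  have hc0 : c ≠ 0 := by
    rintro rfl
    exact hcon 0 (map_zero _) (by simp)
  -- The traces of ϖω𝒪 form an 𝔬-module; if it misses c, it is contained in πc𝔬.
  have key : ∀ y : E, y / ω / ϖ ∈ MaxOrder p E →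
      Algebra.trace K E y / c / π ∈ MaxOrder p K := by
    intro y hy
    rcases eq_or_ne (Algebra.trace K E y) 0 with h0 | h0
    · simp [h0]
    refine hπ.div_mem _ fun hinv => ?_
    rw [inv_div] at hinv
    refine hcon (algebraMap K E (c / Algebra.trace K E y) * y) ?_ ?_
    · rw [← Algebra.smul_def, map_smul, smul_eq_mul, div_mul_cancel₀ _ h0]
    · rw [mul_div_assoc, mul_div_assoc]
      exact mul_mem (algebraMap_mem_maxOrder hinv) hy
  -- Dividing by π, the traces of (ωϖ/π)𝒪 lie in c𝔬, hence in the inverse different of K. So ϖ/π is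
  -- integral, against the integrality of π/ϖ².
  have hx : ω * ϖ / algebraMap K E π ∈ invDifferent p E := by
    intro α
    have h1 := key (ω * ϖ * α) (by
      rw [show ω * ϖ * (α : E) / ω / ϖ = α by field_simp]
      exact α.2)
    have h2 := hc ⟨_, h1⟩
    have h3 : c * (Algebra.trace K E (ω * ϖ * α) / c / π)
        = Algebra.trace K E (ω * ϖ / algebraMap K E π * α) := by
      have h4 : ω * ϖ / algebraMap K E π * (α : E) = π⁻¹ • (ω * ϖ * α) := by
        rw [Algebra.smul_def, map_inv₀]
        ring
      rw [h4, map_smul, smul_eq_mul]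
      field_simp
    rw [h3, trace_trace_padic] at h2
    exact h2
  have h5 := mul_mem (hgen _ hx) hπϖ
  apply hϖ.inv_notMem
  rwa [show ω * ϖ / algebraMap K E π / ω * (algebraMap K E π / ϖ ^ 2) = ϖ⁻¹ by
    field_simp] at h5

/-- In the ramified case, every element of the inverse different of `K` is the trace of a
generator of the inverse different of `E`. -/
theorem exists_generator_trace_eq (hπ : IsUniformizer p π) (hϖ : IsUniformizer p ϖ)
    (hπϖ : algebraMap K E π / ϖ ^ 2 ∈ MaxOrder p E) (hω : ω ≠ 0) (hωmem : ω ∈ invDifferent p E)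
    (hgen : ∀ x ∈ invDifferent p E, x / ω ∈ MaxOrder p E) {c : K} (hc : c ∈ invDifferent p K) :
    ∃ τ : E, τ ≠ 0 ∧ Algebra.trace K E τ = c ∧ τ / ω ∈ MaxOrder p E ∧
      ω / τ ∈ MaxOrder p E := by
  obtain ⟨τ₁, h1, h1'⟩ := exists_trace_eq_of_mem_invDifferent hπ hϖ hπϖ hω hgen hc
  obtain ⟨τ₂, h2, h2'⟩ := exists_trace_eq_of_mem_invDifferent hπ hϖ hπϖ hω hgen
    (trace_mem_invDifferent (K := K) hωmem)
  have hϖ0 := hϖ.ne_zero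
  have hd : (τ₁ - τ₂) / ω / ϖ ∈ MaxOrder p E := by
    rw [sub_div, sub_div]
    exact sub_mem h1' h2'
  have hsum : (τ₁ - τ₂ + ω) / ω = (τ₁ - τ₂) / ω + 1 := by
    field_simp
  have hnot : (τ₁ - τ₂ + ω) / ω / ϖ ∉ MaxOrder p E := by
    rw [hsum]
    exact not_add_div_mem hd hϖ.not_one_div_mem
  -- Since τ₂ and ω have the same trace, ω - τ₂ has trace zero. As τ₁ and τ₂ lie in ϖω𝒪, the sum is
  -- ω times a unit.
  refine ⟨τ₁ - τ₂ + ω, ?_, ?_, ?_, ?_⟩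
  · intro h0
    rw [h0] at hnot
    simp at hnot
  · rw [map_add, map_sub, h1, h2, sub_add_cancel]
  · rw [hsum]
    refine add_mem ?_ (one_mem _)
    have := mul_mem hd hϖ.mem
    rwa [div_mul_cancel₀ _ hϖ0] at this
  · rw [← inv_div]
    exact hϖ.inv_mem_of_not_div_mem hnot

theorem inv_two_mem_maxOrder (hp : p ≠ 2) : (2 : K)⁻¹ ∈ MaxOrder p K := by
  have hn : ‖(2 : ℚ_[p])‖ = 1 := by
    refine le_antisymm (by exact_mod_cast Padic.norm_int_le_one (p := p) 2) ?_
    by_contra! hlt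
    have h1 : ((p : ℕ) : ℤ) ∣ 2 := 
      (Padic.norm_intCast_lt_one_iff (p := p) (k := 2)).1 (by exact_mod_cast hlt)
    have h2 : p ∣ 2 := by exact_mod_cast h1
    exact hp ((Nat.prime_dvd_prime_iff_eq Fact.out Nat.prime_two).1 h2)
  have h2 : ‖(2 : ℚ_[p])⁻¹‖ ≤ 1 := by rw [norm_inv, hn, inv_one]
  obtain ⟨u, hu⟩ : ∃ u : ℤ_[p], algebraMap ℤ_[p] ℚ_[p] u = 2⁻¹ := ⟨⟨_, h2⟩, rfl⟩
  have h3 : (2 : K)⁻¹ = algebraMap ℤ_[p] K u := by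
    rw [IsScalarTower.algebraMap_apply ℤ_[p] ℚ_[p] K, hu, map_inv₀, map_ofNat]
  rw [h3]
  exact isIntegral_algebraMap

/-- In the ramified case, the norms of integers of `E` generate the integers of `K`: an element
of `K` lies in the inverse different as soon as its products with norms have integral trace. -/
theorem mem_invDifferent_of_norms (hquad : Module.finrank K E = 2) {conj : E ≃ₐ[K] E}
    (hconj : conj ≠ 1) (hπ : IsUniformizer p π) (hϖ : IsUniformizer p ϖ)
    (hπϖ : algebraMap K E π / ϖ ^ 2 ∈ MaxOrder p E) {c : K}
    (hc : ∀ (n : K) (α : E), α ∈ MaxOrder p E → algebraMap K E n = α * conj α →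
      Algebra.trace ℚ_[p] K (c * n) ∈ PadicInt.subring p) :
    c ∈ invDifferent p K := by
  have hsq : ∀ b ∈ MaxOrder p K, Algebra.trace ℚ_[p] K (c * (b * b)) ∈ PadicInt.subring p :=
    fun b hb => hc (b * b) (algebraMap K E b) (algebraMap_mem_maxOrder hb) (by simp)
  by_cases hp : p = 2
  swap
  · intro a
    have hb : (a : K) * 2⁻¹ ∈ MaxOrder p K := mul_mem a.2 (inv_two_mem_maxOrder hp)
    have hchar : CharZero K :=
      charZero_of_injective_algebraMap (algebraMap ℚ_[p] K).injective
    -- For odd p, squares of integers of K already generate 𝔬 additively: a = (1 + a/2)² - 1 -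
    -- (a/2)².
    have h1 : c * (a : K) = c * ((1 + a * 2⁻¹) * (1 + a * 2⁻¹)) - c * (1 * 1)
        - c * ((a * 2⁻¹) * (a * 2⁻¹)) := by
      field_simp
      ring
    rw [h1, map_sub, map_sub]
    exact sub_mem (sub_mem (hsq _ (add_mem (one_mem _) hb)) (hsq _ (one_mem _))) (hsq _ hb)
  have hchar : CharZero E :=
      charZero_of_injective_algebraMap (algebraMap ℚ_[p] E).injective
  obtain ⟨ν, hν⟩ := exists_algebraMap_eq_of_conj_eq hquad hconj (x := ϖ * conj ϖ)
    (by rw [map_mul, conj_conj_quadratic hquad hconj, mul_comm])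
  have hϖ0 := hϖ.ne_zero
  have hcϖ0 : conj ϖ ≠ 0 := (map_ne_zero conj).2 hϖ0
  have hπ0 := hπ.ne_zero
  have hν0 : ν ≠ 0 := by
    rintro rfl
    rw [map_zero] at hν
    exact mul_ne_zero hϖ0 hcϖ0 hν.symm
  -- The norm ν of ϖ is a uniformizer of K; this direction rests on ramification.
  have hdiv : π / ν ∈ MaxOrder p K := by
    apply mem_maxOrder_of_algebraMap_mem (E := E)
    have h1 : conj ϖ / ϖ ∈ MaxOrder p E := by
      refine hϖ.div_mem _ fun h2 => hϖ.inv_notMem ?_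
      have := conj_mem_maxOrder conj h2
      rwa [map_inv₀, conj_conj_quadratic hquad hconj] at this
    have h2 := conj_mem_maxOrder conj h1
    rw [map_div₀, conj_conj_quadratic hquad hconj] at h2
    have h3 := mul_mem hπϖ h2
    rwa [show algebraMap K E π / ϖ ^ 2 * (ϖ / conj ϖ) = algebraMap K E (π / ν) by
      rw [map_div₀, hν]
      field_simp] at h3
  have hdiv' : ν / π ∈ MaxOrder p K := by
    refine hπ.div_mem _ fun h1 => hϖ.inv_notMem ?_
    have h2 := mul_mem (algebraMap_mem_maxOrder (E := E) h1) (conj_mem_maxOrder conj hϖ.mem)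
    rwa [map_inv₀, hν, show (ϖ * conj ϖ)⁻¹ * conj ϖ = ϖ⁻¹ by field_simp] at h2
  obtain ⟨m, hm⟩ := hπ.exists_pow_mul_mem c
  have hm' : ν ^ m * c ∈ invDifferent p K := by
    apply mem_invDifferent_of_mem_maxOrder
    have := mul_mem (pow_mem hdiv' m) hm
    rwa [← mul_assoc, ← mul_pow, div_mul_cancel₀ _ hπ0] at this
  -- Descend from a large power of ν: modulo π each integer a is a square b², and νʲb² is the norm
  -- of ϖʲb. The remainder is handled by νʲ⁺¹c.
  have step : ∀ j : ℕ, ν ^ j * c ∈ invDifferent p K → c ∈ invDifferent p K := by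
    intro j
    induction j with
    | zero => intro h0; simpa using h0
    | succ j ih =>
      intro hj
      refine ih fun a => ?_
      obtain ⟨b, hb, d, hd, hab⟩ := exists_sq_add_uniformizer_mul hp hπ a.2
      have h1 : ν ^ j * c * (a : K)
          = c * (ν ^ j * (b * b)) + ν ^ (j + 1) * c * (π / ν * d) := by
        rw [hab]
        field_simp
        ring
      rw [h1, map_add]
      refine add_mem (hc _ (ϖ ^ j * algebraMap K E b)
        (mul_mem (pow_mem hϖ.mem j) (algebraMap_mem_maxOrder hb)) ?_) (hj ⟨_, mul_mem hdiv hd⟩)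
      rw [map_mul, map_pow, hν, map_mul, map_mul conj, map_pow conj, AlgEquiv.commutes]
      ring
  exact step m hm'

end Quadratic

/-! ### Even lattices and their duals. -/

section Lattice

variable {p : ℕ} [Fact p.Prime]
variable {K : Type*} [Field K] [Algebra ℤ_[p] K] [Algebra ℚ_[p] K] [IsScalarTower ℤ_[p] ℚ_[p] K]
  [FiniteDimensional ℚ_[p] K]
variable {E : Type*} [Field E] [Algebra ℤ_[p] E] [Algebra ℚ_[p] E] [IsScalarTower ℤ_[p] ℚ_[p] E]
  [FiniteDimensional ℚ_[p] E]
variable [Algebra K E] [IsScalarTower ℚ_[p] K E] [IsScalarTower ℤ_[p] K E]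
variable {conj : E ≃ₐ[K] E} {V : Type*} [AddCommGroup V] [Module E V]
variable {h : V →ₗ[E] V →ₛₗ[(conj : E →+* E)] E} {L : Submodule (MaxOrder p E) V}
variable {π : K} {ϖ ω : E}

theorem smul_mem_lattice {a : E} (ha : a ∈ MaxOrder p E) {x : V} (hx : x ∈ L) : a • x ∈ L :=
  L.smul_mem ⟨a, ha⟩ hx

/-- Evenness at αx says that twice the trace of c·N(α) lies in 2ℤ_p, where c = h(x,x). Cancelling
the 2 leaves the norm criterion `mem_invDifferent_of_norms`. -/
theorem exists_self_eq_of_mem (hquad : Module.finrank K E = 2) (hconj : conj ≠ 1)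
    (hherm : IsHermitian h) (hπ : IsUniformizer p π) (hϖ : IsUniformizer p ϖ)
    (hπϖ : algebraMap K E π / ϖ ^ 2 ∈ MaxOrder p E) (heven : HasEvenTraceForm p h L) {x : V}
    (hx : x ∈ L) : ∃ c ∈ invDifferent p K, h x x = algebraMap K E c := by
  have hchar : CharZero E := charZero_of_injective_algebraMap (algebraMap ℚ_[p] E).injective
  obtain ⟨c, hc⟩ := exists_algebraMap_eq_of_conj_eq hquad hconj (hherm x x)
  refine ⟨c, mem_invDifferent_of_norms hquad hconj hπ hϖ hπϖ fun n α hα hn => ?_, hc.symm⟩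
  obtain ⟨z, hz⟩ := heven _ (smul_mem_lattice hα hx)
  have h1 : h (α • x) (α • x) = algebraMap K E (c * n) := by
    rw [map_mul, hc, hn, map_smulₛₗ, map_smul, LinearMap.smul_apply, smul_eq_mul, smul_eq_mul]
    change conj α * (α * h x x) = _
    ring
  have h2 : Algebra.trace K E (algebraMap K E (c * n)) = 2 • (c * n) := by
    rw [Algebra.trace_algebraMap, hquad]
  rw [traceForm, h1, ← trace_trace_padic (K := K), h2, map_nsmul, nsmul_eq_mul, Nat.cast_ofNat,
    mul_right_inj' two_ne_zero] at hz
  rw [hz]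
  exact z.2

theorem apply_mem_invDifferent {x y : V} (hx : x ∈ dualLattice p h L) (hy : y ∈ L) :
    h x y ∈ invDifferent p E := by
  intro α
  have h1 := ((dualLattice p h L).smul_mem α hx) y hy
  rw [traceForm] at h1
  have h2 : h (α • x) y = h x y * α := by
    rw [show α • x = (α : E) • x from rfl, map_smul, LinearMap.smul_apply, smul_eq_mul, mul_comm]
  rwa [h2] at h1

theorem mem_dualLattice_of_forall {x : V} (hx : ∀ y ∈ L, h x y ∈ invDifferent p E) :
    x ∈ dualLattice p h L := by
  intro y hy
  have := hx y hy 1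
  rwa [OneMemClass.coe_one, mul_one] at this

/-- By polarization, Tr_{E/K} h(x,y) = h(x+y,x+y) - h(x,x) - h(y,y), and each term lies in the
inverse different of K. -/
theorem le_dualLattice (hquad : Module.finrank K E = 2) (hconj : conj ≠ 1)
    (hherm : IsHermitian h) (hπ : IsUniformizer p π) (hϖ : IsUniformizer p ϖ)
    (hπϖ : algebraMap K E π / ϖ ^ 2 ∈ MaxOrder p E) (heven : HasEvenTraceForm p h L) :
    L ≤ dualLattice p h L := by
  intro x hx y hy
  have key := fun (z : V) (hz : z ∈ L) =>
    exists_self_eq_of_mem hquad hconj hherm hπ hϖ hπϖ heven hz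
  obtain ⟨a, ha, hxa⟩ := key x hx
  obtain ⟨b, hb, hyb⟩ := key y hy
  obtain ⟨c, hc, hxyc⟩ := key (x + y) (add_mem hx hy)
  have h1 : Algebra.trace K E (h x y) = c - a - b := by
    apply (algebraMap K E).injective
    rw [algebraMap_trace_quadratic hquad hconj, hherm, map_sub, map_sub, ← hxa, ← hyb, ← hxyc]
    simp only [map_add, LinearMap.add_apply]
    ring
  have h2 := sub_mem_invDifferent (sub_mem_invDifferent hc ha) hb 1
  rw [OneMemClass.coe_one, mul_one, ← h1, trace_trace_padic] at h2
  exact h2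

theorem mem_unitarySharp_iff {φ : unitaryGroup p h L} :
    φ ∈ unitarySharp p h L ↔ ∀ x ∈ dualLattice p h L, (φ : V ≃ₗ[E] V) x - x ∈ L := by
  rw [unitarySharp, MonoidHom.mem_ker]
  constructor
  · intro h1 x hx
    have h2 : discMap φ (Submodule.Quotient.mk ⟨x, hx⟩) = Submodule.Quotient.mk ⟨x, hx⟩ :=
      LinearEquiv.congr_fun (congrArg Subtype.val h1) (Submodule.Quotient.mk ⟨x, hx⟩)
    exact (Submodule.Quotient.eq (L.submoduleOf (dualLattice p h L))).1 h2
  · intro h1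
    refine Subtype.ext (LinearEquiv.ext fun ξ => ?_)
    induction ξ using Submodule.Quotient.induction_on with
    | H x => exact (Submodule.Quotient.eq _).2 (h1 x x.2)

theorem unitary_mul_apply (φ ψ : unitaryGroup p h L) (x : V) :
    ((φ * ψ : unitaryGroup p h L) : V ≃ₗ[E] V) x = (φ : V ≃ₗ[E] V) ((ψ : V ≃ₗ[E] V) x) :=
  rfl

theorem unitary_inv_apply_eq_iff (φ : unitaryGroup p h L) (x y : V) :
    ((φ⁻¹ : unitaryGroup p h L) : V ≃ₗ[E] V) x = y ↔ x = (φ : V ≃ₗ[E] V) y :=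
  (φ : V ≃ₗ[E] V).symm_apply_eq

/-! ### Symmetries and their action on the lattice. -/

/-- The map `x ↦ x - h(x,s) σ⁻¹ s`. -/
def symmetryMap (h : V →ₗ[E] V →ₛₗ[(conj : E →+* E)] E) (s : V) (σ : E) : V →ₗ[E] V where
  toFun x := x - (h x s * σ⁻¹) • s
  map_add' x y := by
    rw [map_add, LinearMap.add_apply, add_mul, add_smul]
    abel
  map_smul' a x := by
    rw [map_smul, LinearMap.smul_apply, smul_eq_mul, RingHom.id_apply, smul_sub, smul_smul,
      mul_assoc]

theorem symmetryMap_apply (s : V) (σ : E) (x : V) :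
    symmetryMap h s σ x = x - (h x s * σ⁻¹) • s := rfl

/-- With τ = conj σ this identifies the inverse of a symmetry as the symmetry with σ conjugated. -/
theorem symmetryMap_comp {s : V} {σ τ : E} (hσ : σ ≠ 0) (hτ : τ ≠ 0) (hs : h s s = σ + τ) (x : V) :
    symmetryMap h s σ (symmetryMap h s τ x) = x := by
  rw [symmetryMap_apply, symmetryMap_apply, map_sub, map_smul, LinearMap.sub_apply,
    LinearMap.smul_apply, smul_eq_mul, hs, sub_sub, ← add_smul]
  have : h x s * τ⁻¹ + (h x s - h x s * τ⁻¹ * (σ + τ)) * σ⁻¹ = 0 := by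
    field_simp
    ring
  rw [this, zero_smul, sub_zero]

theorem symmetryMap_isometry (hherm : IsHermitian h) {s : V} {σ : E} (hσ : σ ≠ 0)
    (hs : h s s = σ + conj σ) (x y : V) :
    h (symmetryMap h s σ x) (symmetryMap h s σ y) = h x y := by
  have hcσ : conj σ ≠ 0 := (map_ne_zero conj).2 hσ
  have hsmul : ∀ (z : V) (a : E) (w : V), h z (a • w) = conj a * h z w := fun z a w => by
    rw [map_smulₛₗ, smul_eq_mul]
    rfl
  simp only [symmetryMap_apply, map_sub, map_smul, LinearMap.sub_apply, LinearMap.smul_apply,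
    smul_eq_mul, hsmul, map_mul, map_inv₀, hherm y s, hs]
  field_simp
  ring

theorem conj_mem_invDifferent (hquad : Module.finrank K E = 2) (hconj : conj ≠ 1) {x : E}
    (hx : x ∈ invDifferent p E) : conj x ∈ invDifferent p E := by
  intro α
  have h1 := hx ⟨_, conj_mem_maxOrder conj α.2⟩
  rw [← trace_trace_padic (K := K)] at h1 ⊢
  have h2 : Algebra.trace K E (conj x * α) = Algebra.trace K E (x * conj α) := by
    apply (algebraMap K E).injective
    rw [algebraMap_trace_quadratic hquad hconj, algebraMap_trace_quadratic hquad hconj, map_mul,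
      map_mul, conj_conj_quadratic hquad hconj, conj_conj_quadratic hquad hconj, add_comm]
  rwa [h2]

/-- The symmetry attached to `s ∈ L` and a generator `σ` of the inverse different lies in
`U^♯(L)`. -/
theorem exists_symmetry_mem_unitarySharp (hquad : Module.finrank K E = 2) (hconj : conj ≠ 1)
    (hherm : IsHermitian h) (hle : L ≤ dualLattice p h L) (hω : ω ≠ 0)
    (hωmem : ω ∈ invDifferent p E)
    (hgen : ∀ x ∈ invDifferent p E, x / ω ∈ MaxOrder p E) {s : V} (hs : s ∈ L) {σ : E}
    (hσ : σ ≠ 0) (hωσ : ω / σ ∈ MaxOrder p E)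
    (hss : h s s = algebraMap K E (Algebra.trace K E σ)) :
    ∃ φ ∈ unitarySharp p h L, IsSymmetry h (φ : V ≃ₗ[E] V) ∧
      ∀ x, (φ : V ≃ₗ[E] V) x = x - (h x s * σ⁻¹) • s := by
  have hss' : h s s = σ + conj σ := by rw [hss, algebraMap_trace_quadratic hquad hconj]
  have hcσ : conj σ ≠ 0 := (map_ne_zero conj).2 hσ
  let S : V ≃ₗ[E] V :=
    LinearEquiv.ofLinearMap (symmetryMap h s σ) (symmetryMap h s (conj σ))
      (LinearMap.ext (symmetryMap_comp hσ hcσ hss'))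
      (LinearMap.ext (symmetryMap_comp hcσ hσ (hss'.trans (add_comm _ _))))
  have hdual : ∀ τ : E, ω / τ ∈ MaxOrder p E → ∀ x ∈ dualLattice p h L,
      (h x s * τ⁻¹) • s ∈ L := by
    intro τ hτ x hx
    have h1 := mul_mem (hgen _ (apply_mem_invDifferent hx hs)) hτ
    rw [show h x s / ω * (ω / τ) = h x s * τ⁻¹ by field_simp] at h1
    exact smul_mem_lattice h1 hs
  -- The inverse must preserve L as well. The inverse different is stable under conjugation, so conj
  -- σ is as good a denominator as σ.
  have hωcσ : ω / conj σ ∈ MaxOrder p E := by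
    have hcω : conj ω ≠ 0 := (map_ne_zero conj).2 hω
    have h1 := conj_mem_maxOrder conj (hgen _ (conj_mem_invDifferent hquad hconj hωmem))
    have h2 := mul_mem h1 (conj_mem_maxOrder conj hωσ)
    rwa [map_div₀, map_div₀, conj_conj_quadratic hquad hconj, div_mul_div_cancel₀ hcω] at h2
  have hS : ∀ x, S x = x - (h x s * σ⁻¹) • s := fun _ => rfl
  have hS' : ∀ x, S.symm x = x - (h x s * (conj σ)⁻¹) • s := fun _ => rfl
  have hmem : S ∈ unitaryGroup p h L := by
    refine ⟨symmetryMap_isometry hherm hσ hss', fun x => ⟨fun hx => ?_, fun hx => ?_⟩⟩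
    · rw [← S.symm_apply_apply x, hS']
      exact sub_mem hx (hdual _ hωcσ _ (hle hx))
    · rw [hS]
      exact sub_mem hx (hdual _ hωσ _ (hle hx))
  refine ⟨⟨S, hmem⟩, mem_unitarySharp_iff.2 fun x hx => ?_, ⟨s, σ, hσ, hss, hS⟩, hS⟩
  change S x - x ∈ L
  rw [hS, sub_sub_cancel_left]
  exact neg_mem (hdual _ hωσ x hx)

/-! ### Dual systems and transport of a dual vector. -/

/-- A basis of `L` and a dual system of vectors in the dual lattice. -/
theorem exists_basis_dual_system (hnondeg : h.Nondegenerate) (hfg : L.FG)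
    (hfull : Submodule.span E (L : Set V) = ⊤) [FiniteDimensional E V]
    (hωmem : ω ∈ invDifferent p E) (hω : ω ≠ 0) :
    ∃ (ι : Type) (_ : Fintype ι) (_ : DecidableEq ι) (e f : ι → V), (∀ i, e i ∈ L) ∧
      (∀ i, f i ∈ dualLattice p h L) ∧ (∀ i j, h (f i) (e j) = if i = j then ω else 0) ∧
      ∀ x, (∀ i, h (f i) x = 0) → x = 0 := by
  classical
  have hdvr := isDiscreteValuationRing_maxOrder p E
  have hfr := isFractionRing_maxOrder p E
  have hfin : Module.Finite (MaxOrder p E) L := Module.Finite.iff_fg.2 hfg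
  have htf : Module.IsTorsionFree (MaxOrder p E) V := Module.IsTorsionFree.trans_faithfulSMul _ E _
  obtain ⟨n, b⟩ := Module.basisOfFiniteTypeTorsionFree' (R := MaxOrder p E) (M := L)
  let e : Fin n → V := fun i => b i
  have hli : LinearIndependent E e := by
    rw [← LinearIndependent.iff_fractionRing (MaxOrder p E) E]
    exact b.linearIndependent.map' L.subtype (Submodule.ker_subtype L)
  have hLspan : ∀ x ∈ L, ∃ c : Fin n → MaxOrder p E, x = ∑ i, (c i : E) • e i := by
    intro x hx
    refine ⟨b.repr ⟨x, hx⟩, ?_⟩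
    have := congrArg (Subtype.val : L → V) (b.sum_repr ⟨x, hx⟩)
    rw [AddSubmonoidClass.coe_finsetSum] at this
    exact this.symm
  have hspan : ⊤ ≤ Submodule.span E (Set.range e) := by
    rw [← hfull, Submodule.span_le]
    intro x hx
    obtain ⟨c, rfl⟩ := hLspan x hx
    exact sum_mem fun i _ => Submodule.smul_mem _ _ (Submodule.subset_span ⟨i, rfl⟩)
  let B : Module.Basis (Fin n) E V := Module.Basis.mk hli hspan
  have hB : ∀ i, B i = e i := fun i => Module.Basis.mk_apply hli hspan i
  have hsmul : ∀ (z : V) (a : E) (w : V), h z (a • w) = conj a * h z w := fun z a w => by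
    rw [map_smulₛₗ, smul_eq_mul]
    rfl
  -- Non-degeneracy makes x ↦ (h(x, e_j))_j injective, hence bijective by dimension; the f_i are
  -- preimages of ω times the unit vectors.
  let T : V →ₗ[E] (Fin n → E) := LinearMap.pi fun j =>
    { toFun := fun x => h x (e j)
      map_add' := fun x y => by rw [map_add, LinearMap.add_apply]
      map_smul' := fun a x => by rw [map_smul, LinearMap.smul_apply, RingHom.id_apply] }
  have hTinj : Function.Injective T := by
    rw [injective_iff_map_eq_zero]
    intro x hx
    refine hnondeg.1 x fun y => ?_
    have h1 : ∀ j, h x (e j) = 0 := fun j => congrFun hx j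
    rw [← B.sum_repr y, map_sum]
    exact Finset.sum_eq_zero fun j _ => by rw [hsmul, hB, h1, mul_zero]
  have hTsurj : Function.Surjective T := by
    refine (LinearMap.injective_iff_surjective_of_finrank_eq_finrank ?_).1 hTinj
    rw [Module.finrank_eq_card_basis B, Module.finrank_fintype_fun_eq_card]
  choose f hf using fun i => hTsurj (fun j => if i = j then ω else 0)
  have hfe : ∀ i j, h (f i) (e j) = if i = j then ω else 0 := fun i j => congrFun (hf i) j
  refine ⟨Fin n, inferInstance, inferInstance, e, f, fun i => (b i).2, fun i => ?_, hfe, ?_⟩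
  · refine mem_dualLattice_of_forall fun y hy => ?_
    obtain ⟨c, rfl⟩ := hLspan y hy
    simp only [map_sum, hsmul, hfe, mul_ite, mul_zero, Finset.sum_ite_eq, Finset.mem_univ, if_true]
    rw [mul_comm]
    exact mul_mem_invDifferent hωmem (conj_mem_maxOrder conj (c i).2)
  · intro x hx
    have h1 : ∀ i, B.repr x i = 0 := by
      intro i
      have h2 := hx i
      rw [← B.sum_repr x] at h2
      simp only [map_sum, hsmul, hB, hfe, mul_ite, mul_zero, Finset.sum_ite_eq, Finset.mem_univ,
        if_true, mul_eq_zero, hω, or_false, map_eq_zero] at h2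
      exact h2
    rw [← B.sum_repr x]
    exact Finset.sum_eq_zero fun i _ => by rw [h1, zero_smul]

/-- If `h(f, f - φ f)` generates the inverse different, a symmetry in `U^♯(L)` maps `f` to
`φ f`. -/
theorem exists_symmetry_apply_eq (hquad : Module.finrank K E = 2) (hconj : conj ≠ 1)
    (hherm : IsHermitian h) (hle : L ≤ dualLattice p h L) (hω : ω ≠ 0)
    (hωmem : ω ∈ invDifferent p E)
    (hgen : ∀ x ∈ invDifferent p E, x / ω ∈ MaxOrder p E) (hϖ : IsUniformizer p ϖ)
    {φ : unitaryGroup p h L} (hφ : φ ∈ unitarySharp p h L) {f : V} (hf : f ∈ dualLattice p h L)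
    (hnot : h f (f - (φ : V ≃ₗ[E] V) f) / ω / ϖ ∉ MaxOrder p E) :
    ∃ ψ ∈ unitarySharp p h L, IsSymmetry h (ψ : V ≃ₗ[E] V) ∧
      (ψ : V ≃ₗ[E] V) f = (φ : V ≃ₗ[E] V) f ∧
      ∀ x, (φ : V ≃ₗ[E] V) x = x → (ψ : V ≃ₗ[E] V) x = x := by
  set s := f - (φ : V ≃ₗ[E] V) f with hs
  have hsL : s ∈ L := by
    rw [← neg_mem_iff, hs, neg_sub]
    exact mem_unitarySharp_iff.1 hφ f hf
  have hσ : h f s ≠ 0 := fun h0 => ne_zero_of_not_div_mem hnot (by rw [h0, zero_div])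
  have hωσ : ω / h f s ∈ MaxOrder p E := by
    rw [← inv_div]
    exact hϖ.inv_mem_of_not_div_mem hnot
  -- As φ preserves h(f,f), expanding h(s,s) gives h(f,s) + h(s,f).
  have hss : h s s = algebraMap K E (Algebra.trace K E (h f s)) := by
    rw [algebraMap_trace_quadratic hquad hconj, hherm, hs]
    simp only [map_sub, LinearMap.sub_apply, φ.2.1]
    ring
  obtain ⟨ψ, hψ, hsym, hap⟩ :=
    exists_symmetry_mem_unitarySharp hquad hconj hherm hle hω hωmem hgen hsL hσ hωσ hss
  refine ⟨ψ, hψ, hsym, ?_, fun x hx => ?_⟩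
  · rw [hap, mul_inv_cancel₀ hσ, one_smul, hs, sub_sub_cancel]
  -- A fixed vector x satisfies h(x,f) = h(φx,φf) = h(x,φf), so it is orthogonal to s.
  · have h1 : h x s = 0 := by
      rw [hs, map_sub, sub_eq_zero]
      conv_rhs => rw [← hx]
      rw [φ.2.1]
    rw [hap, h1, zero_mul, zero_smul, sub_zero]

/-- The vector `f` can be moved back from `φ f` by a product of symmetries in `U^♯(L)` which fix
all vectors fixed by `φ` and orthogonal to `e`. -/
theorem exists_closure_mul_apply_eq (hquad : Module.finrank K E = 2) (hconj : conj ≠ 1)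
    (hherm : IsHermitian h) (hle : L ≤ dualLattice p h L) (hω : ω ≠ 0)
    (hωmem : ω ∈ invDifferent p E)
    (hgen : ∀ x ∈ invDifferent p E, x / ω ∈ MaxOrder p E) (hϖ : IsUniformizer p ϖ)
    (htrace : ∀ t ∈ L, ∃ τ : E, τ ≠ 0 ∧ h t t = algebraMap K E (Algebra.trace K E τ) ∧
      τ / ω ∈ MaxOrder p E ∧ ω / τ ∈ MaxOrder p E)
    {φ : unitaryGroup p h L} (hφ : φ ∈ unitarySharp p h L) {e f : V}
    (hf : f ∈ dualLattice p h L) (he : e ∈ L) (hfe : h f e = ω) :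
    ∃ g ∈ Subgroup.closure {φ : unitaryGroup p h L |
        φ ∈ unitarySharp p h L ∧ IsSymmetry h (φ : V ≃ₗ[E] V)},
      ((g * φ : unitaryGroup p h L) : V ≃ₗ[E] V) f = f ∧
      ∀ x, h x e = 0 → (φ : V ≃ₗ[E] V) x = x →
        ((g * φ : unitaryGroup p h L) : V ≃ₗ[E] V) x = x := by
  by_cases hnot : h f (f - (φ : V ≃ₗ[E] V) f) / ω / ϖ ∈ MaxOrder p E
  swap
  · obtain ⟨ψ, hψ, hsym, hψf, hfix⟩ :=
      exists_symmetry_apply_eq hquad hconj hherm hle hω hωmem hgen hϖ hφ hf hnot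
    refine ⟨ψ⁻¹, inv_mem (Subgroup.subset_closure ⟨hψ, hsym⟩), ?_, fun x _ hx => ?_⟩
    · rw [unitary_mul_apply, unitary_inv_apply_eq_iff, hψf]
    · rw [unitary_mul_apply, unitary_inv_apply_eq_iff, hx, hfix x hx]
  have hωω : ω / ω / ϖ ∉ MaxOrder p E := by
    rw [div_self hω]
    exact hϖ.not_one_div_mem
  -- Both h(f,e) and h(φf,φe) equal ω. If neither e nor φe works, the cross terms h(φf,e) and
  -- h(f,φe) lie in ϖω𝒪, and then e + φe works.
  obtain ⟨t, htL, htx, hft, hφft⟩ : ∃ t ∈ L,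
      (∀ x, h x e = 0 → (φ : V ≃ₗ[E] V) x = x → h x t = 0) ∧
      h f t / ω / ϖ ∉ MaxOrder p E ∧ h ((φ : V ≃ₗ[E] V) f) t / ω / ϖ ∉ MaxOrder p E := by
    have hφe : ∀ x, h x e = 0 → (φ : V ≃ₗ[E] V) x = x → h x ((φ : V ≃ₗ[E] V) e) = 0 := by
      intro x hx hφx
      rw [← hφx, φ.2.1, hx]
    have hφfe : h ((φ : V ≃ₗ[E] V) f) ((φ : V ≃ₗ[E] V) e) = ω := by rw [φ.2.1, hfe]
    have hφeL : (φ : V ≃ₗ[E] V) e ∈ L := (φ.2.2 e).2 he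
    by_cases h1 : h ((φ : V ≃ₗ[E] V) f) e / ω / ϖ ∈ MaxOrder p E
    swap
    · exact ⟨e, he, fun x hx _ => hx, hfe ▸ hωω, h1⟩
    by_cases h2 : h f ((φ : V ≃ₗ[E] V) e) / ω / ϖ ∈ MaxOrder p E
    swap
    · exact ⟨_, hφeL, hφe, h2, hφfe.symm ▸ hωω⟩
    refine ⟨e + (φ : V ≃ₗ[E] V) e, add_mem he hφeL, fun x hx hφx => ?_, ?_, ?_⟩
    · rw [map_add, hx, hφe x hx hφx, add_zero]
    · rw [map_add, hfe, add_comm, add_div]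
      exact not_add_div_mem h2 hωω
    · rw [map_add, hφfe, add_div]
      exact not_add_div_mem h1 hωω
  obtain ⟨τ, hτ, htt, hτω, hωτ⟩ := htrace t htL
  obtain ⟨ρ, hρ, hρsym, hρap⟩ :=
    exists_symmetry_mem_unitarySharp hquad hconj hherm hle hω hωmem hgen htL hτ hωτ htt
  have hρfix : ∀ x, h x e = 0 → (φ : V ≃ₗ[E] V) x = x →
      ((ρ * φ : unitaryGroup p h L) : V ≃ₗ[E] V) x = x := by
    intro x hx hφx
    rw [unitary_mul_apply, hφx, hρap, htx x hx hφx, zero_mul, zero_smul, sub_zero]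
  have hnew : h f (f - ((ρ * φ : unitaryGroup p h L) : V ≃ₗ[E] V) f) / ω / ϖ
      ∉ MaxOrder p E := by
    have h1 : h f (f - ((ρ * φ : unitaryGroup p h L) : V ≃ₗ[E] V) f) =
        h f (f - (φ : V ≃ₗ[E] V) f) +
          conj (h ((φ : V ≃ₗ[E] V) f) t * τ⁻¹) * h f t := by
      rw [unitary_mul_apply, hρap, ← sub_add, map_add, map_smulₛₗ, smul_eq_mul]
      rfl
    rw [h1, add_div]
    -- The old value lies in ϖω𝒪, while the correction is a unit times the generator h(f,t).
    refine not_add_div_mem hnot ?_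
    rw [mul_div_assoc]
    refine hϖ.not_mul_div_mem ?_ hft
    have hq0 : h ((φ : V ≃ₗ[E] V) f) t ≠ 0 := fun h0 =>
      ne_zero_of_not_div_mem hφft (by rw [h0, zero_div])
    have hinv : (h ((φ : V ≃ₗ[E] V) f) t * τ⁻¹)⁻¹ ∈ MaxOrder p E := by
      have := mul_mem (hϖ.inv_mem_of_not_div_mem hφft) hτω
      rwa [inv_div, div_mul_div_cancel₀' hω, ← inv_div, div_eq_mul_inv] at this
    refine hϖ.not_div_mem_of_inv_mem
      ((map_ne_zero conj).2 (mul_ne_zero hq0 (inv_ne_zero hτ))) ?_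
    rw [← map_inv₀]
    exact conj_mem_maxOrder conj hinv
  obtain ⟨ψ, hψ, hsym, hψf, hfix⟩ :=
    exists_symmetry_apply_eq hquad hconj hherm hle hω hωmem hgen hϖ (mul_mem hρ hφ) hf hnew
  refine ⟨ψ⁻¹ * ρ, mul_mem (inv_mem (Subgroup.subset_closure ⟨hψ, hsym⟩))
    (Subgroup.subset_closure ⟨hρ, hρsym⟩), ?_, fun x hx hφx => ?_⟩
  · rw [mul_assoc, unitary_mul_apply, unitary_inv_apply_eq_iff, hψf]
  · rw [mul_assoc, unitary_mul_apply, unitary_inv_apply_eq_iff, hρfix x hx hφx,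
      hfix x (hρfix x hx hφx)]

end Lattice

end HermLattice

end

/-! ### Factorization of U^♯(L) into symmetries. -/

theorem mainTheorem12 (p : ℕ) [Fact p.Prime]
    (K : Type*) [Field K] [Algebra ℤ_[p] K] [Algebra ℚ_[p] K] [IsScalarTower ℤ_[p] ℚ_[p] K]
    [FiniteDimensional ℚ_[p] K]
    (E : Type*) [Field E] [Algebra ℤ_[p] E] [Algebra ℚ_[p] E] [IsScalarTower ℤ_[p] ℚ_[p] E]
    [Algebra K E] [IsScalarTower ℚ_[p] K E] [IsScalarTower ℤ_[p] K E]
    (hquad : Module.finrank K E = 2)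
    (hram : HermLattice.IsRamified p K E)
    (conj : E ≃ₐ[K] E) (hconj : conj ≠ 1)
    (V : Type*) [AddCommGroup V] [Module E V] [FiniteDimensional E V]
    (h : V →ₗ[E] V →ₛₗ[(conj : E →+* E)] E)
    (hherm : HermLattice.IsHermitian h)
    (hnondeg : h.Nondegenerate)
    (L : Submodule (HermLattice.MaxOrder p E) V)
    (hfg : L.FG)
    (hfull : Submodule.span E (L : Set V) = ⊤)
    (heven : HermLattice.HasEvenTraceForm p h L) :
    HermLattice.unitarySharp p h L = HermLattice.symmetrySharp p h L ∧
    HermLattice.unitarySharp p h L =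
      Subgroup.closure {φ : HermLattice.unitaryGroup p h L |
        φ ∈ HermLattice.unitarySharp p h L ∧ HermLattice.IsSymmetry h (φ : V ≃ₗ[E] V)} := by
  open HermLattice in
  have hfd : FiniteDimensional K E := Module.finite_of_finrank_eq_succ hquad
  have hfdE : FiniteDimensional ℚ_[p] E := Module.Finite.trans K E
  obtain ⟨π, ϖ, hπ, hϖ, hπϖ⟩ := exists_uniformizers hram
  obtain ⟨ω, hω, hωmem, hgen⟩ := exists_generator_invDifferent hϖ
  have hle := le_dualLattice hquad hconj hherm hπ hϖ hπϖ heven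
  obtain ⟨ι, hι, hdec, e, f, he, hf, hfe, hsep⟩ :=
    exists_basis_dual_system (h := h) hnondeg hfg hfull hωmem hω
  have htrace : ∀ t ∈ L, ∃ τ : E, τ ≠ 0 ∧ h t t = algebraMap K E (Algebra.trace K E τ) ∧
      τ / ω ∈ MaxOrder p E ∧ ω / τ ∈ MaxOrder p E := by
    intro t ht
    obtain ⟨c, hc, htc⟩ := exists_self_eq_of_mem hquad hconj hherm hπ hϖ hπϖ heven ht
    obtain ⟨τ, hτ, hτc, h1, h2⟩ := exists_generator_trace_eq hπ hϖ hπϖ hω hωmem hgen hc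
    exact ⟨τ, hτ, by rw [htc, hτc], h1, h2⟩
  have hcle : Subgroup.closure {φ : unitaryGroup p h L |
      φ ∈ unitarySharp p h L ∧ IsSymmetry h (φ : V ≃ₗ[E] V)} ≤ unitarySharp p h L :=
    (Subgroup.closure_le _).2 fun φ hφ => hφ.1
  -- Induction on a set S of indices outside of which φ already fixes the f_i.
  have main : ∀ (S : Finset ι) (φ : unitaryGroup p h L), φ ∈ unitarySharp p h L →
      (∀ i, i ∉ S → (φ : V ≃ₗ[E] V) (f i) = f i) →
      φ ∈ Subgroup.closure {φ : unitaryGroup p h L |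
        φ ∈ unitarySharp p h L ∧ IsSymmetry h (φ : V ≃ₗ[E] V)} := by
    intro S
    induction S using Finset.induction_on with
    | empty =>
      intro φ _ hfix
      have h1 : φ = 1 := by
        refine Subtype.ext (LinearEquiv.ext fun x => sub_eq_zero.1 (hsep _ fun i => ?_))
        have h2 : h (f i) ((φ : V ≃ₗ[E] V) x) = h (f i) x := by
          conv_lhs => rw [← hfix i (Finset.notMem_empty i)]
          exact φ.2.1 _ _
        exact (map_sub (h (f i)) _ _).trans (sub_eq_zero.2 h2)
      rw [h1]
      exact one_mem _
    | insert k S hk ih =>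
      intro φ hφ hfix
      obtain ⟨g, hg, hgk, hgfix⟩ := exists_closure_mul_apply_eq hquad hconj hherm hle hω hωmem
        hgen hϖ htrace hφ (hf k) (he k) (by rw [hfe, if_pos rfl])
      have h1 := ih (g * φ) (mul_mem (hcle hg) hφ) fun i hi => by
        rcases eq_or_ne i k with rfl | hik
        · exact hgk
        -- For i ≠ k, f_i is orthogonal to e_k, so correcting f_k does not disturb it.
        · exact hgfix _ (by rw [hfe, if_neg hik])
            (hfix i (by rw [Finset.mem_insert]; tauto))
      exact (Subgroup.mul_mem_cancel_left _ hg).1 h1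
  have hgenerated := le_antisymm (fun φ hφ => main Finset.univ φ hφ fun i hi =>
    absurd (Finset.mem_univ i) hi) hcle
  refine ⟨le_antisymm (le_inf le_rfl ?_) inf_le_left, hgenerated⟩
  rw [hgenerated]
  exact Subgroup.closure_mono fun φ hφ => hφ.2
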